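/- Let $X\subseteq\mathbb R^m$ be a bounded convex Borel set (for instance a bounded convex domain, open or closed), let $\mathcal P(X)$ be the set of Borel probability measures on $X$ with the weak topology, and fix $\nu\in\mathcal P(X)$. For $\mu_0,\mu_1\in\mathcal P(X)$ let $\Pi(\mu_0,\mu_1)$ be the set of probability measures on $X\times X$ with marginals $\mu_0,\mu_1$, let $W_2^2(\mu_0,\mu_1)=\inf_{\pi\in\Pi(\mu_0,\mu_1)}\int|x_0-x_1|^2\,d\pi(x_0,x_1)$, and let $\Pi_{opt}(\nu,\mu_i)$ be the set of minimizers of $\int |x_i-y|^2\,d\pi(y,x_i)$ over $\pi\in\Pi(\nu,\mu_i)$. Define $$W_\nu^2(\mu_0,\mu_1)=\inf\Big\{\int_{X^3}|x_0-x_1|^2\,d\gamma(y,x_0,x_1)\ :\ \gamma\in\mathcal P(X^3),\ \gamma_{yx_i}\in\Pi_{opt}(\nu,\mu_i),\ i=0,1\Big\},$$ where $\gamma_{yx_i}$ is the push-forward of $\gamma$ under $(y,x_0,x_1)\mapsto(y,x_i)$, and, for $\epsilon>0$, $$MM_\nu^\epsilon(\mu_0,\mu_1)=\inf_{\gamma\in\Pi(\nu,\mu_0,\mu_1)}\int_{X^3}\big[\epsilon|x_0-x_1|^2+|x_0-y|^2+|x_1-y|^2\big]\,d\gamma(y,x_0,x_1),$$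 where $\Pi(\nu,\mu_0,\mu_1)$ is the set of probability measures on $X^3$ with marginals $\nu,\mu_0,\mu_1$. Then the functionals on $\mathcal P(X)\times\mathcal P(X)$ $$F_\nu^\epsilon(\mu_0,\mu_1)=\tfrac1\epsilon MM_\nu^\epsilon(\mu_0,\mu_1)-\tfrac1\epsilon W_2^2(\nu,\mu_0)-\tfrac1\epsilon W_2^2(\nu,\mu_1)$$ $\Gamma$-converge to $W_\nu^2$ as $\epsilon\to0^+$ with respect to the product of the weak topologies on $\mathcal P(X)\times\mathcal P(X)$. That is, for all $\mu_0,\mu_1\in\mathcal P(X)$: (1) whenever $(\mu_0^\epsilon,\mu_1^\epsilon)\to(\mu_0,\mu_1)$ weakly as $\epsilon\to0^+$, $W_\nu^2(\mu_0,\mu_1)\le\liminf_{\epsilon\to0^+}F_\nu^\epsilon(\mu_0^\epsilon,\mu_1^\epsilon)$; (2) there exist $(\mu_0^\epsilon,\mu_1^\epsilon)\to(\mu_0,\mu_1)$ weakly with $\limsup_{\epsilon\to0^+}F_\nu^\epsilon(\mu_0^\epsilon,\mu_1^\epsilon)\le W_\nu^2(\mu_0,\mu_1)$. -/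

import Mathlib

open MeasureTheory Filter Topology
open scoped ENNReal

noncomputable section

namespace BasedWasserstein

/-- The marginal of a probability measure under the projection `(a, b) ↦ a`. -/
def marg1 {A B : Type*} [MeasurableSpace A] [MeasurableSpace B]
    (π : ProbabilityMeasure (A × B)) : ProbabilityMeasure A :=
  π.map (f := Prod.fst) measurable_fst.aemeasurable

/-- The marginal of a probability measure under the projection `(a, b) ↦ b`. -/
def marg2 {A B : Type*} [MeasurableSpace A] [MeasurableSpace B]
    (π : ProbabilityMeasure (A × B)) : ProbabilityMeasure B :=
  π.map (f := Prod.snd) measurable_snd.aemeasurable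

section Metric

variable {X : Type*} [MetricSpace X] [MeasurableSpace X]

/-- `Π(ν, μ)`: the probability measures on `X × X` with marginals `ν` and `μ`. -/
def couplings (ν μ : ProbabilityMeasure X) : Set (ProbabilityMeasure (X × X)) :=
  {π | marg1 π = ν ∧ marg2 π = μ}

/-- `∫ |x - y|² dπ(x, y)`. -/
def quadCost (π : ProbabilityMeasure (X × X)) : ℝ≥0∞ :=
  ∫⁻ p, edist p.1 p.2 ^ 2 ∂(π : Measure (X × X))

/-- `Π_opt(ν, μ)`: the minimizers of the quadratic cost over `Π(ν, μ)`. -/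
def optCouplings (ν μ : ProbabilityMeasure X) : Set (ProbabilityMeasure (X × X)) :=
  {π | π ∈ couplings ν μ ∧ ∀ π' ∈ couplings ν μ, quadCost π ≤ quadCost π'}

/-- The quadratic Wasserstein distance `W₂`. -/
def W2 (μ₀ μ₁ : ProbabilityMeasure X) : ℝ≥0∞ :=
  (⨅ π ∈ couplings μ₀ μ₁, quadCost π) ^ (1 / 2 : ℝ)

/-- The projection `γ_{y x₀}` of `γ`, where points of `X × X × X` are written `(y, x₀, x₁)`. -/
def margYX0 (γ : ProbabilityMeasure (X × X × X)) : ProbabilityMeasure (X × X) :=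
  γ.map (f := fun p => (p.1, p.2.1)) (by fun_prop)

/-- The projection `γ_{y x₁}` of `γ`. -/
def margYX1 (γ : ProbabilityMeasure (X × X × X)) : ProbabilityMeasure (X × X) :=
  γ.map (f := fun p => (p.1, p.2.2)) (by fun_prop)

/-- The projection `γ_{x₀ x₁}` of `γ`. -/
def margX0X1 (γ : ProbabilityMeasure (X × X × X)) : ProbabilityMeasure (X × X) :=
  marg2 γ

/-- `Π(ν, μ₀, μ₁)`: the probability measures on `X × X × X` with marginals `ν`, `μ₀`, `μ₁`. -/
def couplings3 (ν μ₀ μ₁ : ProbabilityMeasure X) : Set (ProbabilityMeasure (X × X × X)) :=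
  {γ | marg1 γ = ν ∧ marg1 (margX0X1 γ) = μ₀ ∧ marg2 (margX0X1 γ) = μ₁}

/-- The admissible set for `W_ν`: measures `γ` with `γ_{y xᵢ} ∈ Π_opt(ν, μᵢ)` for `i = 0, 1`. -/
def basedCouplings (ν μ₀ μ₁ : ProbabilityMeasure X) : Set (ProbabilityMeasure (X × X × X)) :=
  {γ | margYX0 γ ∈ optCouplings ν μ₀ ∧ margYX1 γ ∈ optCouplings ν μ₁}

/-- The `ν`-based Wasserstein metric `W_ν`. -/
def Wbased (ν μ₀ μ₁ : ProbabilityMeasure X) : ℝ≥0∞ :=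
  (⨅ γ ∈ basedCouplings ν μ₀ μ₁,
    ∫⁻ p, edist p.2.1 p.2.2 ^ 2 ∂(γ : Measure (X × X × X))) ^ (1 / 2 : ℝ)

/-- The multi-marginal problem `MM_ν^ε(μ₀, μ₁)`, for `ε > 0`. -/
def MM (ν : ProbabilityMeasure X) (ε : ℝ) (μ₀ μ₁ : ProbabilityMeasure X) : ℝ≥0∞ :=
  ⨅ γ ∈ couplings3 ν μ₀ μ₁,
    ∫⁻ p, (ENNReal.ofReal ε * edist p.2.1 p.2.2 ^ 2 + edist p.2.1 p.1 ^ 2 + edist p.2.2 p.1 ^ 2)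
      ∂(γ : Measure (X × X × X))

/-- `F_ν^ε(μ₀, μ₁) = (1/ε) MM_ν^ε(μ₀, μ₁) - (1/ε) W₂²(ν, μ₀) - (1/ε) W₂²(ν, μ₁)`.
On a bounded space all three terms are finite. -/
def Ffun (ν : ProbabilityMeasure X) (ε : ℝ) (μ : ProbabilityMeasure X × ProbabilityMeasure X) :
    EReal :=
  ((1 / ε : ℝ) : EReal) * ((MM ν ε μ.1 μ.2 : ℝ≥0∞) : EReal)
    - ((1 / ε : ℝ) : EReal) * ((W2 ν μ.1 ^ 2 : ℝ≥0∞) : EReal)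
    - ((1 / ε : ℝ) : EReal) * ((W2 ν μ.2 ^ 2 : ℝ≥0∞) : EReal)

end Metric

/-- Γ-convergence of the functionals `F i` to `F₀` along the filter `l`: the liminf inequality
for every convergent family and the existence of a recovery family at every point. -/
def GammaConverges {ι T : Type*} [TopologicalSpace T] (l : Filter ι) (F : ι → T → EReal)
    (F₀ : T → EReal) : Prop :=
  ∀ x : T,
    (∀ u : ι → T, Tendsto u l (𝓝 x) → F₀ x ≤ liminf (fun i => F i (u i)) l) ∧
    ∃ u : ι → T, Tendsto u l (𝓝 x) ∧ limsup (fun i => F i (u i)) l ≤ F₀ x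

end BasedWasserstein

end

open MeasureTheory Filter Topology
open scoped ENNReal

noncomputable section

namespace BasedWasserstein

open scoped NNReal

/-! The cost in `MM` splits as `ε * A + B₀ + B₁`, where `A` is the `x₀x₁` cost of the plan and `Bᵢ`
the transport cost of its projection to `(y, xᵢ)`, with `Bᵢ ≥ W2 ν μᵢ ^ 2`. A based plan attains
equality in both, so testing `MM` with it gives `Ffun ≤ Wbased ^ 2` for every `ε > 0`, and the
constant family is a recovery family (`Ffun_le_Wbased_sq`).

For the lower bound, `Ffun < c` yields a plan with `A ≤ c` and both `Bᵢ` within `ε * c` of optimal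
(`exists_couplings3_of_Ffun_lt`). Such plans have a limit as `ε → 0`. Since `X` need not be closed,
the limit is taken on a compactification `K`; its marginals are carried by `X`, so it comes back to
`X × X × X` (`exists_limit_couplings3`). The quadratic costs are continuous on `K` and pass to the
limit, so `A ≤ c` survives.

It remains to see that the limit projections are optimal (`mem_optCouplings_of_tendsto`). This needs
upper semicontinuity of `W2 ν · ^ 2` under weak convergence, obtained by transferring a plan to a
nearby target through a partition of unity (`eventually_exists_coupling_quadCost_le`). -/

/-- A totally bounded metric space carries finite continuous partitions of unity subordinate to
balls of any given radius. -/
lemma exists_finite_partitionOfUnity {X : Type*} [MetricSpace X]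
    (hX : TotallyBounded (Set.univ : Set X)) {δ : ℝ} (hδ : 0 < δ) :
    ∃ (t : Finset X) (φ : X → X → ℝ≥0), (∀ z, Continuous (φ z)) ∧
      (∀ x, ∑ z ∈ t, φ z x = 1) ∧ ∀ z x, φ z x ≠ 0 → dist x z < δ := by
  obtain ⟨t, htf, ht⟩ := Metric.totallyBounded_iff.1 hX δ hδ
  -- The balls cover the space, so the tent functions have a positive sum and can be normalised.
  have hpos : ∀ x, 0 < ∑ z ∈ htf.toFinset, (δ - dist x z).toNNReal := by
    intro x
    obtain ⟨z, hz, hxz⟩ := Set.mem_iUnion₂.1 (ht (Set.mem_univ x))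
    refine Finset.sum_pos' (fun _ _ => zero_le) ⟨z, by simpa using hz, ?_⟩
    simpa using hxz
  refine ⟨htf.toFinset,
    fun z x => (δ - dist x z).toNNReal / ∑ w ∈ htf.toFinset, (δ - dist x w).toNNReal,
    fun z => ?_, fun x => ?_, fun z x h => ?_⟩
  · refine Continuous.div (by fun_prop) (by fun_prop) fun x => (hpos x).ne'
  · rw [← Finset.sum_div, div_self (hpos x).ne']
  · by_contra hc
    exact h (by simp [Real.toNNReal_of_nonpos (sub_nonpos.2 (not_lt.1 hc))])

/-! ### Transferring a plan to a nearby second marginal -/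

section Weights

variable {X : Type*} [MetricSpace X] [MeasurableSpace X]

lemma toMeasure_marg2 {A B : Type*} [MeasurableSpace A] [MeasurableSpace B]
    (π : ProbabilityMeasure (A × B)) :
    ((marg2 π : ProbabilityMeasure B) : Measure B) = (π : Measure (A × B)).map Prod.snd := rfl

/-- A density on a product of two probability spaces whose partial integrals are all one
yields a plan between the two factors. -/
lemma exists_probabilityMeasure_of_density {A B Y : Type*} [MeasurableSpace A]
    [MeasurableSpace B] [MeasurableSpace Y]
    (π : ProbabilityMeasure (A × Y)) (ρ : ProbabilityMeasure B) {h : (A × Y) × B → ℝ≥0∞}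
    (hm : Measurable h)
    (h₁ : ∀ᵐ p ∂(π : Measure (A × Y)), ∫⁻ x, h (p, x) ∂(ρ : Measure B) = 1)
    (h₂ : ∀ x, ∫⁻ p, h (p, x) ∂(π : Measure (A × Y)) = 1) :
    ∃ σ : ProbabilityMeasure (A × B), marg1 σ = marg1 π ∧ marg2 σ = ρ ∧
      ∀ f : A × B → ℝ≥0∞, Measurable f → ∫⁻ q, f q ∂(σ : Measure (A × B)) =
        ∫⁻ p, ∫⁻ x, h (p, x) * f (p.1, x) ∂(ρ : Measure B) ∂(π : Measure (A × Y)) := by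
  have hT : Measurable (fun p : (A × Y) × B => (p.1.1, p.2)) := by fun_prop
  -- Reweight the product, then forget `Y`: the density may depend on the old target, which does not
  -- survive in the new plan.
  set M : Measure (A × B) := (((π : Measure (A × Y)).prod (ρ : Measure B)).withDensity h).map
    (fun p => (p.1.1, p.2)) with hM
  have hint : ∀ f : A × B → ℝ≥0∞, Measurable f → ∫⁻ q, f q ∂M =
      ∫⁻ p, ∫⁻ x, h (p, x) * f (p.1, x) ∂(ρ : Measure B) ∂(π : Measure (A × Y)) := by
    intro f hf
    have hfT : Measurable fun p : (A × Y) × B => f (p.1.1, p.2) := hf.comp hT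
    rw [hM, lintegral_map hf hT, lintegral_withDensity_eq_lintegral_mul _ hm hfT,
      lintegral_prod _ (hm.mul hfT).aemeasurable]
    rfl
  have hint₁ : ∀ f : A → ℝ≥0∞, Measurable f →
      ∫⁻ q, f q.1 ∂M = ∫⁻ p, f p.1 ∂(π : Measure (A × Y)) := by
    intro f hf
    rw [hint (fun q => f q.1) (hf.comp measurable_fst)]
    refine lintegral_congr_ae ?_
    filter_upwards [h₁] with p hp
    rw [lintegral_mul_const _ (by fun_prop), hp, one_mul]
  have hint₂ : ∀ f : B → ℝ≥0∞, Measurable f →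
      ∫⁻ q, f q.2 ∂M = ∫⁻ x, f x ∂(ρ : Measure B) := by
    intro f hf
    rw [hint (fun q => f q.2) (hf.comp measurable_snd), lintegral_lintegral_swap]
    · refine lintegral_congr fun x => ?_
      simp only
      rw [lintegral_mul_const _ (by fun_prop), h₂, one_mul]
    · exact (hm.mul (hf.comp measurable_snd)).aemeasurable
  have hprob : IsProbabilityMeasure M := ⟨by
    have := hint₁ (fun _ => 1) measurable_const
    simpa using this⟩
  refine ⟨⟨M, hprob⟩, Subtype.ext ?_, Subtype.ext ?_, hint⟩
  · change M.map Prod.fst = (π : Measure (A × Y)).map Prod.fst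
    ext s hs
    have := hint₁ (s.indicator 1) (measurable_one.indicator hs)
    rw [← lintegral_map (measurable_one.indicator hs) measurable_fst,
      ← lintegral_map (measurable_one.indicator hs) measurable_fst,
      lintegral_indicator_one hs, lintegral_indicator_one hs] at this
    exact this
  · change M.map Prod.snd = (ρ : Measure B)
    ext s hs
    have := hint₂ (s.indicator 1) (measurable_one.indicator hs)
    rw [← lintegral_map (measurable_one.indicator hs) measurable_snd,
      lintegral_indicator_one hs, lintegral_indicator_one hs] at this
    exact this

/-- If `μ'` charges every weight of a partition of unity at least `t` times as much as `μ`, a plan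
from `ν` to `μ` can be transferred to a plan from `ν` to `μ'` at a controlled cost. -/
lemma exists_coupling_quadCost_le_of_weights [SecondCountableTopology X] [BorelSpace X]
    {ν μ μ' : ProbabilityMeasure X} {π : ProbabilityMeasure (X × X)} (hπ : π ∈ couplings ν μ)
    {ι : Type*} (s : Finset ι) {φ : ι → X → ℝ≥0∞} (hφm : ∀ i, Measurable (φ i))
    (hφ : ∀ x, ∑ i ∈ s, φ i x = 1) {t η D : ℝ≥0∞} (ht : t ≤ 1)
    (hab : ∀ i ∈ s, t * ∫⁻ x, φ i x ∂(μ : Measure X) ≤ ∫⁻ x, φ i x ∂(μ' : Measure X))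
    (ht₀ : t ≠ 0)
    (hη : ∀ i x x' y, φ i x ≠ 0 → φ i x' ≠ 0 → edist y x' ^ 2 ≤ edist y x ^ 2 + η)
    (hD : ∀ x y : X, edist x y ^ 2 ≤ D) :
    ∃ π' ∈ couplings ν μ', quadCost π' ≤ quadCost π + η + (1 - t) * D := by
  set a : ι → ℝ≥0∞ := fun i => ∫⁻ x, φ i x ∂(μ : Measure X) with ha
  set b : ι → ℝ≥0∞ := fun i => ∫⁻ x, φ i x ∂(μ' : Measure X) with hb
  have ht_top : t ≠ ⊤ := ne_top_of_le_ne_top ENNReal.one_ne_top ht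
  have hsum : ∀ ρ : ProbabilityMeasure X, ∑ i ∈ s, ∫⁻ x, φ i x ∂(ρ : Measure X) = 1 := by
    intro ρ
    rw [← lintegral_finsetSum _ fun i _ => hφm i]
    simp [hφ]
  have hb_top : ∀ i ∈ s, b i ≠ ⊤ := fun i hi => ne_top_of_le_ne_top ENNReal.one_ne_top
    ((Finset.single_le_sum (f := b) (fun _ _ => zero_le) hi).trans_eq (hsum μ'))
  -- Since `t ≠ 0`, a weight with `b i = 0` also has no `μ`-mass, so the infinite factor `(b i)⁻¹`
  -- only ever meets a zero in the integrals below.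
  have ha₀ : ∀ i ∈ s, b i = 0 → a i = 0 := by
    intro i hi h0
    have := hab i hi
    change t * a i ≤ b i at this
    rw [h0, nonpos_iff_eq_zero, mul_eq_zero] at this
    exact this.resolve_left ht₀
  have haπ : ∀ i, ∫⁻ p, φ i p.2 ∂(π : Measure (X × X)) = a i := by
    intro i
    rw [ha, ← hπ.2, toMeasure_marg2]
    exact (lintegral_map (hφm i) measurable_snd).symm
  have hnull : ∀ᵐ p ∂(π : Measure (X × X)), ∀ i ∈ s, b i = 0 → φ i p.2 = 0 := by
    refine (Finset.eventually_all s).2 fun i hi => ?_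
    by_cases h0 : b i = 0
    · have := haπ i
      rw [ha₀ i hi h0, lintegral_eq_zero_iff (by fun_prop)] at this
      filter_upwards [this] with p hp _ using hp
    · exact Eventually.of_forall fun p h => absurd h h0
  -- `H` sends a fraction `t` of the mass to new targets under the same weight `φ i`, distributed
  -- there like `μ'`. Its second marginal has density `G` with respect to `μ'`, and `t * a i ≤ b i`
  -- gives `G ≤ 1`. The deficit `1 - G`, of total mass `1 - t`, is filled independently of the old
  -- plan.
  set G : X → ℝ≥0∞ := fun x => t * ∑ i ∈ s, a i * (b i)⁻¹ * φ i x with hG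
  set H : (X × X) × X → ℝ≥0∞ := fun p => t * ∑ i ∈ s, φ i p.1.2 * φ i p.2 * (b i)⁻¹ with hH
  have hGm : Measurable G := by fun_prop
  have hHm : Measurable H := by fun_prop
  have hG1 : ∀ x, G x ≤ 1 := by
    intro x
    rw [← hφ x, hG]
    simp only
    rw [Finset.mul_sum]
    refine Finset.sum_le_sum fun i hi => ?_
    calc t * (a i * (b i)⁻¹ * φ i x) = (t * a i) * (b i)⁻¹ * φ i x := by ring
      _ ≤ b i * (b i)⁻¹ * φ i x := by gcongr; exact hab i hi
      _ ≤ 1 * φ i x := by gcongr; rw [mul_comm]; exact ENNReal.inv_mul_le_one _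
      _ = φ i x := one_mul _
  have hGint : ∫⁻ x, G x ∂(μ' : Measure X) = t := by
    rw [hG, lintegral_const_mul _ (by fun_prop), lintegral_finsetSum _ (by fun_prop)]
    have : ∀ i ∈ s, ∫⁻ x, a i * (b i)⁻¹ * φ i x ∂(μ' : Measure X) = a i := by
      intro i hi
      rw [lintegral_const_mul _ (hφm i)]
      change a i * (b i)⁻¹ * b i = a i
      by_cases h0 : b i = 0
      · simp [ha₀ i hi h0]
      · rw [mul_assoc, ENNReal.inv_mul_cancel h0 (hb_top i hi), mul_one]
    rw [Finset.sum_congr rfl this, hsum μ, mul_one]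
  have hGsub : ∫⁻ x, (1 - G x) ∂(μ' : Measure X) = 1 - t := by
    rw [lintegral_sub hGm (by rw [hGint]; exact ht_top) (Eventually.of_forall hG1), hGint]
    simp
  have hH₁ : ∀ᵐ p ∂(π : Measure (X × X)), ∫⁻ x, H (p, x) ∂(μ' : Measure X) = t := by
    filter_upwards [hnull] with p hp
    rw [hH, lintegral_const_mul _ (by fun_prop), lintegral_finsetSum _ (by fun_prop)]
    have : ∀ i ∈ s, ∫⁻ x, φ i p.2 * φ i x * (b i)⁻¹ ∂(μ' : Measure X) = φ i p.2 := by
      intro i hi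
      rw [lintegral_mul_const _ (by fun_prop), lintegral_const_mul _ (hφm i)]
      change φ i p.2 * b i * (b i)⁻¹ = φ i p.2
      by_cases h0 : b i = 0
      · simp [hp i hi h0]
      · rw [mul_assoc, ENNReal.mul_inv_cancel h0 (hb_top i hi), mul_one]
    rw [Finset.sum_congr rfl this, hφ, mul_one]
  have hH₂ : ∀ x, ∫⁻ p, H (p, x) ∂(π : Measure (X × X)) = G x := by
    intro x
    rw [hH, hG, lintegral_const_mul _ (by fun_prop), lintegral_finsetSum _ (by fun_prop)]
    simp only
    congr 1
    refine Finset.sum_congr rfl fun i _ => ?_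
    rw [lintegral_mul_const _ (by fun_prop), lintegral_mul_const _ (by fun_prop), haπ]
    ring
  obtain ⟨σ, hσ₁, hσ₂, hσ⟩ := exists_probabilityMeasure_of_density π μ'
    (h := fun p => H p + (1 - G p.2)) (by fun_prop)
    (by
      filter_upwards [hH₁] with p hp
      rw [lintegral_add_right _ (by fun_prop), hp, hGsub, add_tsub_cancel_of_le ht])
    (by
      intro x
      rw [lintegral_add_right _ (by fun_prop), hH₂]
      simp [add_tsub_cancel_of_le (hG1 x)])
  refine ⟨σ, ⟨hσ₁.trans hπ.1, hσ₂⟩, ?_⟩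
  rw [quadCost, hσ _ (by fun_prop), quadCost]
  -- `H` only charges old and new targets under a common weight, where `hη` applies; the independent
  -- remainder is charged the crude bound `D`.
  have hpt : ∀ (p : X × X) (x : X), H (p, x) * edist p.1 x ^ 2 ≤
      H (p, x) * (edist p.1 p.2 ^ 2 + η) := by
    intro p x
    rw [hH]
    simp only
    rw [mul_assoc, mul_assoc, Finset.sum_mul, Finset.sum_mul]
    gcongr t * ?_
    refine Finset.sum_le_sum fun i _ => ?_
    by_cases h0 : φ i p.2 = 0
    · simp [h0]
    by_cases h1 : φ i x = 0
    · simp [h1]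
    gcongr
    exact hη i _ _ _ h0 h1
  calc ∫⁻ p, ∫⁻ x, (H (p, x) + (1 - G x)) * edist p.1 x ^ 2 ∂(μ' : Measure X)
        ∂(π : Measure (X × X))
      ≤ ∫⁻ p, (edist p.1 p.2 ^ 2 + η + (1 - t) * D) ∂(π : Measure (X × X)) := by
        refine lintegral_mono_ae ?_
        filter_upwards [hH₁] with p hp
        calc ∫⁻ x, (H (p, x) + (1 - G x)) * edist p.1 x ^ 2 ∂(μ' : Measure X)
            ≤ ∫⁻ x, (H (p, x) * (edist p.1 p.2 ^ 2 + η) + (1 - G x) * D) ∂(μ' : Measure X) := by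
              refine lintegral_mono fun x => ?_
              rw [add_mul]
              refine add_le_add (hpt p x) ?_
              gcongr
              exact hD _ _
          _ = t * (edist p.1 p.2 ^ 2 + η) + (1 - t) * D := by
              rw [lintegral_add_right _ (by fun_prop), lintegral_mul_const _ (by fun_prop),
                lintegral_mul_const _ (by fun_prop), hp, hGsub]
          _ ≤ 1 * (edist p.1 p.2 ^ 2 + η) + (1 - t) * D := by gcongr
          _ = _ := by rw [one_mul]
    _ = _ := by
        rw [lintegral_add_right _ measurable_const, lintegral_add_right _ measurable_const]
        simp

end Weights

/-- Upper semicontinuity of the transport cost in the second marginal, on a bounded space: every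
plan from `ν` to `μ` can be transferred to all `μ'` weakly close to `μ` at almost no extra cost. -/
lemma eventually_exists_coupling_quadCost_le {X : Type*} [MetricSpace X] [MeasurableSpace X]
    [BorelSpace X] [SecondCountableTopology X] (hX : TotallyBounded (Set.univ : Set X))
    {ν μ : ProbabilityMeasure X} {π : ProbabilityMeasure (X × X)} (hπ : π ∈ couplings ν μ)
    {κ : ℝ} (hκ : 0 < κ) :
    ∀ᶠ μ' : ProbabilityMeasure X in 𝓝 μ,
      ∃ π' ∈ couplings ν μ', quadCost π' ≤ quadCost π + ENNReal.ofReal κ := by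
  obtain ⟨R, hR⟩ := Metric.isBounded_iff.1 hX.isBounded
  replace hR : ∀ x y : X, dist x y ≤ R := fun x y => hR (Set.mem_univ x) (Set.mem_univ y)
  have hR0 : 0 ≤ R := by
    obtain ⟨x⟩ := ν.nonempty
    exact dist_nonneg.trans (hR x x)
  -- Moving the target by at most `2 * δ` raises the squared distance by at most `4 * δ * R + 4 * δ
  -- ^ 2`, which is at most `4 * δ * (R + 1)` because `δ ≤ 1`.
  set δ : ℝ := min 1 (κ / (8 * (R + 1))) with hδ
  have hδ0 : 0 < δ := by positivity
  have hδ1 : 4 * δ * R + 4 * δ ^ 2 ≤ κ / 2 := by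
    have h1 : δ ≤ 1 := min_le_left _ _
    have h2 : δ * (8 * (R + 1)) ≤ κ := (le_div_iff₀ (by positivity)).1 (min_le_right _ _)
    nlinarith
  -- `s` is the untransferred fraction, costing at most `s * R ^ 2`; `s ≤ 1 / 2` keeps `t = 1 - s`
  -- positive.
  set s : ℝ := min (1 / 2) (κ / (2 * (R ^ 2 + 1))) with hs
  have hs0 : 0 < s := by positivity
  have hs1 : s ≤ 1 / 2 := min_le_left _ _
  have hsR : s * R ^ 2 ≤ κ / 2 := by
    have : s * (2 * (R ^ 2 + 1)) ≤ κ := (le_div_iff₀ (by positivity)).1 (min_le_right _ _)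
    nlinarith
  obtain ⟨T, φ, hφc, hφ, hφδ⟩ := exists_finite_partitionOfUnity hX hδ0
  have hφ1 : ∀ z ∈ T, ∀ x, φ z x ≤ 1 := fun z hz x =>
    (Finset.single_le_sum (f := fun z => φ z x) (fun _ _ => zero_le) hz).trans_eq (hφ x)
  have hcont : ∀ z ∈ T,
      Continuous fun μ' : ProbabilityMeasure X => ∫⁻ x, (φ z x : ℝ≥0∞) ∂(μ' : Measure X) := by
    intro z hz
    refine ProbabilityMeasure.continuous_lintegral_boundedContinuousFunction
      (BoundedContinuousFunction.mkOfBound ⟨φ z, hφc z⟩ 1 fun x y => ?_)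
    have h1 : (φ z x : ℝ) ≤ 1 := by exact_mod_cast hφ1 z hz x
    have h2 : (φ z y : ℝ) ≤ 1 := by exact_mod_cast hφ1 z hz y
    rw [NNReal.dist_eq, abs_le]
    constructor <;> simp only [ContinuousMap.coe_mk] <;>
      linarith [(φ z x).coe_nonneg, (φ z y).coe_nonneg]
  have hev : ∀ᶠ μ' : ProbabilityMeasure X in 𝓝 μ, ∀ z ∈ T,
      ENNReal.ofReal (1 - s) * ∫⁻ x, (φ z x : ℝ≥0∞) ∂(μ : Measure X) ≤
        ∫⁻ x, (φ z x : ℝ≥0∞) ∂(μ' : Measure X) := by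
    refine (Finset.eventually_all T).2 fun z hz => ?_
    -- Weak continuity preserves a strict inequality only, and strictness needs positive mass.
    by_cases h0 : ∫⁻ x, (φ z x : ℝ≥0∞) ∂(μ : Measure X) = 0
    · simp [h0]
    · have htop : ∫⁻ x, (φ z x : ℝ≥0∞) ∂(μ : Measure X) ≠ ⊤ := by
        refine ne_top_of_le_ne_top ENNReal.one_ne_top ?_
        calc ∫⁻ x, (φ z x : ℝ≥0∞) ∂(μ : Measure X) ≤ ∫⁻ _, 1 ∂(μ : Measure X) :=
              lintegral_mono fun x => ENNReal.coe_le_one_iff.2 (hφ1 z hz x)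
          _ = 1 := by simp
      have hlt : ENNReal.ofReal (1 - s) * ∫⁻ x, (φ z x : ℝ≥0∞) ∂(μ : Measure X) <
          ∫⁻ x, (φ z x : ℝ≥0∞) ∂(μ : Measure X) := by
        conv_rhs => rw [← one_mul (∫⁻ x, (φ z x : ℝ≥0∞) ∂(μ : Measure X))]
        refine ENNReal.mul_lt_mul_left h0 htop ?_
        rw [ENNReal.ofReal_lt_one]
        linarith
      filter_upwards [(hcont z hz).continuousAt.eventually_const_lt hlt] with μ' h using h.le
  filter_upwards [hev] with μ' hμ'
  obtain ⟨π', hπ', hle⟩ := exists_coupling_quadCost_le_of_weights hπ (μ' := μ') T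
    (φ := fun z x => (φ z x : ℝ≥0∞)) (t := ENNReal.ofReal (1 - s))
    (η := ENNReal.ofReal (κ / 2)) (D := ENNReal.ofReal (R ^ 2))
    (fun z => (hφc z).measurable.coe_nnreal_ennreal)
    (fun x => by exact_mod_cast hφ x)
    (by rw [ENNReal.ofReal_le_one]; linarith) hμ'
    (by rw [Ne, ENNReal.ofReal_eq_zero, not_le]; linarith)
    (by
      intro z x x' y hx hx'
      have h1 : dist x z < δ := hφδ z x (by simpa using hx)
      have h2 : dist x' z < δ := hφδ z x' (by simpa using hx')
      have h3 : dist y x' ≤ dist y x + 2 * δ := by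
        have := dist_triangle y x x'
        have := dist_triangle_right x x' z
        linarith
      rw [edist_dist, edist_dist, ← ENNReal.ofReal_pow dist_nonneg,
        ← ENNReal.ofReal_pow dist_nonneg, ← ENNReal.ofReal_add (by positivity) (by positivity)]
      refine ENNReal.ofReal_le_ofReal ?_
      have h4 := hR y x
      calc dist y x' ^ 2 ≤ (dist y x + 2 * δ) ^ 2 := by gcongr
        _ ≤ dist y x ^ 2 + κ / 2 := by nlinarith)
    (by
      intro x y
      rw [edist_dist, ← ENNReal.ofReal_pow dist_nonneg]
      have := hR x y
      gcongr)
  refine ⟨π', hπ', hle.trans ?_⟩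
  have : (1 - ENNReal.ofReal (1 - s)) * ENNReal.ofReal (R ^ 2) ≤ ENNReal.ofReal (κ / 2) := by
    rw [← ENNReal.ofReal_one, ← ENNReal.ofReal_sub _ (by linarith),
      ← ENNReal.ofReal_mul (by linarith)]
    refine ENNReal.ofReal_le_ofReal ?_
    linarith
  calc quadCost π + ENNReal.ofReal (κ / 2) + (1 - ENNReal.ofReal (1 - s)) * ENNReal.ofReal (R ^ 2)
      ≤ quadCost π + ENNReal.ofReal (κ / 2) + ENNReal.ofReal (κ / 2) := by gcongr
    _ = quadCost π + ENNReal.ofReal κ := by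
      rw [add_assoc, ← ENNReal.ofReal_add (by positivity) (by positivity), add_halves]

/-! ### Limits of three-marginal plans through a compactification -/

section Compactness

variable {X K : Type*} [MetricSpace X] [MeasurableSpace X] [BorelSpace X]
  [MetricSpace K] [MeasurableSpace K] [BorelSpace K] [CompactSpace K]

/-- Pulling back along a measurable embedding undoes the push-forward, so marginals on `X` can be
identified inside `K`. -/
lemma eq_of_map_eq {A B : Type*} [MeasurableSpace A] [MeasurableSpace B] {j : A → B}
    (hj : MeasurableEmbedding j) {μ μ' : Measure A} (h : μ.map j = μ'.map j) : μ = μ' := by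
  rw [← hj.comap_map μ, h, hj.comap_map]

/-- Three-marginal plans whose marginals converge in `X` have, along any ultrafilter, a limit plan
in `X`, where limits are tested against continuous functions on a compactification `K`. -/
lemma exists_limit_couplings3 {j : X → K} (hjc : Continuous j) (hj : MeasurableEmbedding j)
    {ι : Type*} (𝒰 : Ultrafilter ι) {ν μ₀ μ₁ : ProbabilityMeasure X}
    {u₀ u₁ : ι → ProbabilityMeasure X} (hu₀ : Tendsto u₀ 𝒰 (𝓝 μ₀)) (hu₁ : Tendsto u₁ 𝒰 (𝓝 μ₁))
    {γs : ι → ProbabilityMeasure (X × X × X)}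
    (hγs : ∀ᶠ i in (𝒰 : Filter ι), γs i ∈ couplings3 ν (u₀ i) (u₁ i)) :
    ∃ γ ∈ couplings3 ν μ₀ μ₁, ∀ g : K × K × K → ℝ≥0, Continuous g →
      Tendsto (fun i => ∫⁻ p, g (j p.1, j p.2.1, j p.2.2) ∂(γs i : Measure (X × X × X))) 𝒰
        (𝓝 (∫⁻ p, g (j p.1, j p.2.1, j p.2.2) ∂(γ : Measure (X × X × X)))) := by
  set J : X × X × X → K × K × K := Prod.map j (Prod.map j j) with hJdef
  have hJ : MeasurableEmbedding J := hj.prodMap (hj.prodMap hj)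
  have hJm : Measurable J := hJ.measurable
  set Γs : ι → ProbabilityMeasure (K × K × K) := fun i => (γs i).map hJm.aemeasurable with hΓs
  obtain ⟨Γ, -, hΓ⟩ := isCompact_univ.ultrafilter_le_nhds (𝒰.map Γs) (by simp)
  replace hΓ : Tendsto Γs 𝒰 (𝓝 Γ) := hΓ
  -- Marginals commute with the limit: each one converges both to the marginal of `Γ` and to the
  -- image of the prescribed limit in `X`.
  have key : ∀ (q : K × K × K → K) (r : X × X × X → X), Continuous q → Measurable r →
      (∀ p, q (J p) = j (r p)) → ∀ (v : ι → ProbabilityMeasure X) (μ : ProbabilityMeasure X),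
      Tendsto v 𝒰 (𝓝 μ) →
      (∀ᶠ i in (𝒰 : Filter ι), (γs i : Measure (X × X × X)).map r = (v i : Measure X)) →
      (Γ : Measure (K × K × K)).map q = (μ : Measure X).map j := by
    intro q r hq hr hqr v μ hv hγv
    have h1 := ProbabilityMeasure.tendsto_map_of_tendsto_of_continuous _ _ hΓ hq
    have h2 := ProbabilityMeasure.tendsto_map_of_tendsto_of_continuous _ _ hv hjc
    have h3 : (fun i => (v i).map hjc.measurable.aemeasurable) =ᶠ[(𝒰 : Filter ι)]
        fun i => (Γs i).map hq.measurable.aemeasurable := by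
      filter_upwards [hγv] with i hi
      refine Subtype.ext ?_
      change (v i : Measure X).map j = ((γs i : Measure (X × X × X)).map J).map q
      rw [← hi, Measure.map_map hjc.measurable hr, Measure.map_map hq.measurable hJm]
      congr 1
      funext p
      exact (hqr p).symm
    have h4 := tendsto_nhds_unique h1 (h2.congr' h3)
    exact congrArg Subtype.val h4
  have k₀ := key (fun p => p.1) (fun p => p.1) (by fun_prop) (by fun_prop) (fun _ => rfl)
    (fun _ => ν) ν tendsto_const_nhds
    (by filter_upwards [hγs] with i hi using congrArg Subtype.val hi.1)
  have k₁ := key (fun p => p.2.1) (fun p => p.2.1) (by fun_prop) (by fun_prop) (fun _ => rfl)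
    u₀ μ₀ hu₀
    (by
      filter_upwards [hγs] with i hi
      have := congrArg Subtype.val hi.2.1
      rw [← ProbabilityMeasure.val_eq_to_measure, ← ProbabilityMeasure.val_eq_to_measure, ← this]
      exact (Measure.map_map measurable_fst measurable_snd).symm)
  have k₂ := key (fun p => p.2.2) (fun p => p.2.2) (by fun_prop) (by fun_prop) (fun _ => rfl)
    u₁ μ₁ hu₁
    (by
      filter_upwards [hγs] with i hi
      have := congrArg Subtype.val hi.2.2
      rw [← ProbabilityMeasure.val_eq_to_measure, ← ProbabilityMeasure.val_eq_to_measure, ← this]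
      exact (Measure.map_map measurable_snd measurable_snd).symm)
  have hae : ∀ (q : K × K × K → K) (μ : ProbabilityMeasure X), Measurable q →
      (Γ : Measure (K × K × K)).map q = (μ : Measure X).map j →
      ∀ᵐ p ∂(Γ : Measure (K × K × K)), q p ∈ Set.range j := by
    intro q μ hq h
    refine ae_of_ae_map hq.aemeasurable (p := fun x => x ∈ Set.range j) ?_
    rw [h, hj.ae_map_iff]
    exact Eventually.of_forall fun x => ⟨x, rfl⟩
  -- No mass escapes to `K \ X`: each of the three marginals of `Γ` is carried by the image of `X`.
  -- This takes the place of a tightness argument.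
  have hrange : ∀ᵐ p ∂(Γ : Measure (K × K × K)), p ∈ Set.range J := by
    filter_upwards [hae _ _ (by fun_prop) k₀, hae _ _ (by fun_prop) k₁, hae _ _ (by fun_prop) k₂]
    rintro ⟨a, b, c⟩ ⟨x, hx⟩ ⟨y, hy⟩ ⟨z, hz⟩
    exact ⟨(x, y, z), by simp only at hx hy hz; simp [hJdef, hx, hy, hz]⟩
  set γ : Measure (X × X × X) := (Γ : Measure (K × K × K)).comap J with hγ
  have hmap : γ.map J = (Γ : Measure (K × K × K)) := by
    rw [hγ, hJ.map_comap, Measure.restrict_eq_self_of_ae_mem hrange]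
  have hprob : IsProbabilityMeasure γ := by
    refine ⟨?_⟩
    have : γ.map J Set.univ = 1 := by rw [hmap]; exact measure_univ
    rwa [Measure.map_apply hJm MeasurableSet.univ, Set.preimage_univ] at this
  have hmarg : ∀ (q : K × K × K → K) (r : X × X × X → X) (μ : ProbabilityMeasure X),
      Measurable q → Measurable r → (∀ p, q (J p) = j (r p)) →
      (Γ : Measure (K × K × K)).map q = (μ : Measure X).map j → γ.map r = (μ : Measure X) := by
    intro q r μ hq hr hqr h
    refine eq_of_map_eq hj ?_
    rw [← h, ← hmap, Measure.map_map hj.measurable hr, Measure.map_map hq hJm]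
    congr 1
    funext p
    exact (hqr p).symm
  refine ⟨⟨γ, hprob⟩, ⟨Subtype.ext ?_, Subtype.ext ?_, Subtype.ext ?_⟩, fun g hg => ?_⟩
  · exact hmarg _ (fun p => p.1) ν (by fun_prop) (by fun_prop) (fun _ => rfl) k₀
  · refine Eq.trans ?_
      (hmarg _ (fun p => p.2.1) μ₀ (by fun_prop) (by fun_prop) (fun _ => rfl) k₁)
    exact Measure.map_map measurable_fst measurable_snd
  · refine Eq.trans ?_
      (hmarg _ (fun p => p.2.2) μ₁ (by fun_prop) (by fun_prop) (fun _ => rfl) k₂)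
    exact Measure.map_map measurable_snd measurable_snd
  · have h1 := ((ProbabilityMeasure.continuous_lintegral_continuousMap
      (⟨g, hg⟩ : C(K × K × K, ℝ≥0))).tendsto Γ).comp hΓ
    have hgm : Measurable fun p => (g p : ℝ≥0∞) := hg.measurable.coe_nnreal_ennreal
    have h2 : ∫⁻ p, (g p : ℝ≥0∞) ∂(Γ : Measure (K × K × K)) =
        ∫⁻ p, (g (J p) : ℝ≥0∞) ∂γ := by rw [← hmap, lintegral_map hgm hJm]
    have h3 : ∀ i, ∫⁻ p, (g p : ℝ≥0∞) ∂(Γs i : Measure (K × K × K)) =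
        ∫⁻ p, (g (J p) : ℝ≥0∞) ∂(γs i : Measure (X × X × X)) := fun i => lintegral_map hgm hJm
    change Tendsto (fun i => ∫⁻ p, (g (J p) : ℝ≥0∞) ∂(γs i : Measure (X × X × X))) 𝒰
      (𝓝 (∫⁻ p, (g (J p) : ℝ≥0∞) ∂γ))
    rw [← h2]
    simp only [← h3]
    exact h1

end Compactness

/-! ### Marginals and existence of couplings -/

section Couplings

variable {X : Type*} [MeasurableSpace X]

lemma margYX0_mem_couplings {ν μ₀ μ₁ : ProbabilityMeasure X}
    {γ : ProbabilityMeasure (X × X × X)} (hγ : γ ∈ couplings3 ν μ₀ μ₁) :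
    margYX0 γ ∈ couplings ν μ₀ := by
  obtain ⟨rfl, rfl, rfl⟩ := hγ
  constructor <;> refine Subtype.ext ?_
  · exact Measure.map_map measurable_fst (by fun_prop)
  · exact (Measure.map_map measurable_snd (by fun_prop)).trans
      (Measure.map_map measurable_fst measurable_snd).symm

lemma margYX1_mem_couplings {ν μ₀ μ₁ : ProbabilityMeasure X}
    {γ : ProbabilityMeasure (X × X × X)} (hγ : γ ∈ couplings3 ν μ₀ μ₁) :
    margYX1 γ ∈ couplings ν μ₁ := by
  obtain ⟨rfl, rfl, rfl⟩ := hγ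
  constructor <;> refine Subtype.ext ?_
  · exact Measure.map_map measurable_fst (by fun_prop)
  · exact (Measure.map_map measurable_snd (by fun_prop)).trans
      (Measure.map_map measurable_snd measurable_snd).symm

lemma couplings_nonempty (ν μ : ProbabilityMeasure X) : (couplings ν μ).Nonempty := by
  refine ⟨ν.prod μ, Subtype.ext ?_, Subtype.ext ?_⟩
  · change ((ν : Measure X).prod (μ : Measure X)).map Prod.fst = ν
    simp
  · change ((ν : Measure X).prod (μ : Measure X)).map Prod.snd = μ
    simp

lemma couplings3_nonempty (ν μ₀ μ₁ : ProbabilityMeasure X) :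
    (couplings3 ν μ₀ μ₁).Nonempty := by
  have h : marg2 (ν.prod (μ₀.prod μ₁)) = μ₀.prod μ₁ := by
    refine Subtype.ext ?_
    change ((ν : Measure X).prod ((μ₀ : Measure X).prod (μ₁ : Measure X))).map Prod.snd = _
    simp
  refine ⟨ν.prod (μ₀.prod μ₁), Subtype.ext ?_, ?_, ?_⟩
  · change ((ν : Measure X).prod ((μ₀ : Measure X).prod (μ₁ : Measure X))).map Prod.fst = ν
    simp
  · rw [margX0X1, h]
    refine Subtype.ext ?_
    change ((μ₀ : Measure X).prod (μ₁ : Measure X)).map Prod.fst = μ₀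
    simp
  · rw [margX0X1, h]
    refine Subtype.ext ?_
    change ((μ₀ : Measure X).prod (μ₁ : Measure X)).map Prod.snd = μ₁
    simp

end Couplings

lemma lintegral_edist_sq_lt_top {X A : Type*} [MetricSpace X] [MeasurableSpace A] {R : ℝ≥0}
    (hR : ∀ x y : X, edist x y ≤ R) (ρ : ProbabilityMeasure A) (f g : A → X) :
    ∫⁻ a, edist (f a) (g a) ^ 2 ∂(ρ : Measure A) < ⊤ := by
  calc ∫⁻ a, edist (f a) (g a) ^ 2 ∂(ρ : Measure A)
      ≤ ∫⁻ _, (R : ℝ≥0∞) ^ 2 ∂(ρ : Measure A) := by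
        refine lintegral_mono fun a => ?_
        gcongr
        exact hR _ _
    _ < ⊤ := by
        rw [lintegral_const, measure_univ, mul_one]
        exact ENNReal.pow_lt_top ENNReal.coe_lt_top

/-- Plays the role of passing to a subsequence: a small liminf gives good plans only frequently. -/
lemma exists_ultrafilter_eventually_of_frequently {α : Type*} {l : Filter α} {p : α → Prop}
    (h : ∃ᶠ x in l, p x) : ∃ 𝒰 : Ultrafilter α, ↑𝒰 ≤ l ∧ ∀ᶠ x in (𝒰 : Filter α), p x := by
  have : (l ⊓ 𝓟 {x | p x}).NeBot := frequently_mem_iff_neBot.1 h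
  exact ⟨Ultrafilter.of _, (Ultrafilter.of_le _).trans inf_le_left,
    (Ultrafilter.of_le _).trans inf_le_right (mem_principal_self _)⟩

/-! ### The functionals and the two Γ-convergence inequalities -/

section Functionals

variable {X : Type*} [MetricSpace X] [MeasurableSpace X]

lemma ENNReal_sq_rpow_half (a : ℝ≥0∞) : (a ^ (1 / 2 : ℝ)) ^ 2 = a := by
  rw [← ENNReal.rpow_natCast, ← ENNReal.rpow_mul]
  norm_num

lemma W2_sq (μ₀ μ₁ : ProbabilityMeasure X) :
    W2 μ₀ μ₁ ^ 2 = ⨅ π ∈ couplings μ₀ μ₁, quadCost π := ENNReal_sq_rpow_half _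

lemma Wbased_sq (ν μ₀ μ₁ : ProbabilityMeasure X) :
    Wbased ν μ₀ μ₁ ^ 2 = ⨅ γ ∈ basedCouplings ν μ₀ μ₁,
      ∫⁻ p, edist p.2.1 p.2.2 ^ 2 ∂(γ : Measure (X × X × X)) := ENNReal_sq_rpow_half _

lemma W2_sq_eq_quadCost {μ₀ μ₁ : ProbabilityMeasure X} {π : ProbabilityMeasure (X × X)}
    (hπ : π ∈ optCouplings μ₀ μ₁) : W2 μ₀ μ₁ ^ 2 = quadCost π := by
  rw [W2_sq]
  exact le_antisymm (iInf₂_le π hπ.1) (le_iInf₂ hπ.2)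

/-- The two projections to `(y, xᵢ)` determine all three marginals; hence based plans compete in
`MM`. -/
lemma basedCouplings_subset_couplings3 (ν μ₀ μ₁ : ProbabilityMeasure X) :
    basedCouplings ν μ₀ μ₁ ⊆ couplings3 ν μ₀ μ₁ := by
  rintro γ ⟨⟨⟨h₁, h₂⟩, -⟩, ⟨⟨-, h₃⟩, -⟩⟩
  refine ⟨?_, ?_, ?_⟩
  · rw [← h₁]
    refine Subtype.ext (Eq.symm ?_)
    exact Measure.map_map measurable_fst (by fun_prop)
  · rw [← h₂]
    refine Subtype.ext (Eq.symm ?_)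
    exact (Measure.map_map measurable_snd (by fun_prop)).trans
      (Measure.map_map measurable_fst measurable_snd).symm
  · rw [← h₃]
    refine Subtype.ext (Eq.symm ?_)
    exact (Measure.map_map measurable_snd (by fun_prop)).trans
      (Measure.map_map measurable_snd measurable_snd).symm

lemma W2_sq_ne_top {R : ℝ≥0} (hR : ∀ x y : X, edist x y ≤ R) (ν μ : ProbabilityMeasure X) :
    W2 ν μ ^ 2 ≠ ⊤ := by
  obtain ⟨π, hπ⟩ := couplings_nonempty ν μ
  rw [W2_sq]
  exact ((iInf₂_le π hπ).trans_lt (lintegral_edist_sq_lt_top hR π Prod.fst Prod.snd)).ne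

variable [BorelSpace X] [SecondCountableTopology X]

lemma quadCost_margYX0 (γ : ProbabilityMeasure (X × X × X)) :
    quadCost (margYX0 γ) = ∫⁻ p, edist p.2.1 p.1 ^ 2 ∂(γ : Measure (X × X × X)) := by
  refine (lintegral_map (f := fun p : X × X => edist p.1 p.2 ^ 2) (by fun_prop)
    (by fun_prop)).trans (lintegral_congr fun p => ?_)
  rw [edist_comm]

lemma quadCost_margYX1 (γ : ProbabilityMeasure (X × X × X)) :
    quadCost (margYX1 γ) = ∫⁻ p, edist p.2.2 p.1 ^ 2 ∂(γ : Measure (X × X × X)) := by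
  refine (lintegral_map (f := fun p : X × X => edist p.1 p.2 ^ 2) (by fun_prop)
    (by fun_prop)).trans (lintegral_congr fun p => ?_)
  rw [edist_comm]

lemma lintegral_MM_cost (γ : ProbabilityMeasure (X × X × X)) (ε : ℝ) :
    ∫⁻ p, (ENNReal.ofReal ε * edist p.2.1 p.2.2 ^ 2 + edist p.2.1 p.1 ^ 2 + edist p.2.2 p.1 ^ 2)
      ∂(γ : Measure (X × X × X)) =
    ENNReal.ofReal ε * ∫⁻ p, edist p.2.1 p.2.2 ^ 2 ∂(γ : Measure (X × X × X)) +
      quadCost (margYX0 γ) + quadCost (margYX1 γ) := by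
  rw [quadCost_margYX0, quadCost_margYX1, lintegral_add_right _ (by fun_prop),
    lintegral_add_right _ (by fun_prop), lintegral_const_mul _ (by fun_prop)]

lemma MM_ne_top {R : ℝ≥0} (hR : ∀ x y : X, edist x y ≤ R) (ν μ₀ μ₁ : ProbabilityMeasure X)
    (ε : ℝ) : MM ν ε μ₀ μ₁ ≠ ⊤ := by
  obtain ⟨γ, hγ⟩ := couplings3_nonempty ν μ₀ μ₁
  refine ((iInf₂_le γ hγ).trans_lt ?_).ne
  rw [lintegral_MM_cost]
  exact ENNReal.add_lt_top.2 ⟨ENNReal.add_lt_top.2 ⟨ENNReal.mul_lt_top ENNReal.ofReal_lt_top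
    (lintegral_edist_sq_lt_top hR γ _ _),
    lintegral_edist_sq_lt_top hR (margYX0 γ) Prod.fst Prod.snd⟩,
    lintegral_edist_sq_lt_top hR (margYX1 γ) Prod.fst Prod.snd⟩

/-- Boundedness makes all three terms finite, so the `EReal` subtractions are real ones. -/
lemma Ffun_eq_coe {R : ℝ≥0} (hR : ∀ x y : X, edist x y ≤ R) (ν : ProbabilityMeasure X) (ε : ℝ)
    (μ : ProbabilityMeasure X × ProbabilityMeasure X) :
    Ffun ν ε μ = ((((MM ν ε μ.1 μ.2).toReal - (W2 ν μ.1 ^ 2).toReal - (W2 ν μ.2 ^ 2).toReal) / ε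
      : ℝ) : EReal) := by
  rw [Ffun, ← EReal.coe_ennreal_toReal (MM_ne_top hR ν μ.1 μ.2 ε),
    ← EReal.coe_ennreal_toReal (W2_sq_ne_top hR ν μ.1),
    ← EReal.coe_ennreal_toReal (W2_sq_ne_top hR ν μ.2)]
  norm_cast
  ring

/-- The upper bound underlying the constant recovery family. -/
lemma Ffun_le_Wbased_sq {R : ℝ≥0} (hR : ∀ x y : X, edist x y ≤ R) (ν : ProbabilityMeasure X)
    {ε : ℝ} (hε : 0 < ε) (μ : ProbabilityMeasure X × ProbabilityMeasure X) :
    Ffun ν ε μ ≤ ((Wbased ν μ.1 μ.2 ^ 2 : ℝ≥0∞) : EReal) := by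
  rw [Ffun_eq_coe hR]
  -- This covers an empty set of based plans, so their existence need not be known.
  by_cases htop : Wbased ν μ.1 μ.2 ^ 2 = ⊤
  · simp [htop]
  rw [← EReal.coe_ennreal_toReal htop, EReal.coe_le_coe_iff, div_le_iff₀ hε]
  have h : MM ν ε μ.1 μ.2 ≤ ENNReal.ofReal ε * Wbased ν μ.1 μ.2 ^ 2 + W2 ν μ.1 ^ 2 +
      W2 ν μ.2 ^ 2 := by
    rw [Wbased_sq, ENNReal.mul_iInf_of_ne (by simpa using hε) ENNReal.ofReal_ne_top]
    simp only [ENNReal.mul_iInf_of_ne (a := ENNReal.ofReal ε) (by simpa using hε)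
      ENNReal.ofReal_ne_top, ENNReal.iInf_add]
    refine le_iInf₂ fun γ hγ => ?_
    refine (iInf₂_le γ (basedCouplings_subset_couplings3 _ _ _ hγ)).trans_eq ?_
    rw [lintegral_MM_cost, W2_sq_eq_quadCost hγ.1, W2_sq_eq_quadCost hγ.2]
  have h' := ENNReal.toReal_mono (by
    simp [ENNReal.mul_eq_top, htop, W2_sq_ne_top hR, -ENNReal.pow_eq_top_iff]) h
  rw [ENNReal.toReal_add (by simp [ENNReal.mul_eq_top, htop, W2_sq_ne_top hR,
      -ENNReal.pow_eq_top_iff]) (W2_sq_ne_top hR _ _),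
    ENNReal.toReal_add (by simp [ENNReal.mul_eq_top, htop, -ENNReal.pow_eq_top_iff])
      (W2_sq_ne_top hR _ _),
    ENNReal.toReal_mul, ENNReal.toReal_ofReal hε.le] at h'
  linarith

/-- A bound on `Ffun` produces a three-marginal plan with bounded cost and almost optimal
projections. -/
lemma exists_couplings3_of_Ffun_lt {R : ℝ≥0} (hR : ∀ x y : X, edist x y ≤ R)
    {ν : ProbabilityMeasure X} {ε c : ℝ} (hε : 0 < ε)
    {μ : ProbabilityMeasure X × ProbabilityMeasure X} (h : Ffun ν ε μ < (c : EReal)) :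
    0 ≤ c ∧ ∃ γ ∈ couplings3 ν μ.1 μ.2,
      ∫⁻ p, edist p.2.1 p.2.2 ^ 2 ∂(γ : Measure (X × X × X)) ≤ ENNReal.ofReal c ∧
      quadCost (margYX0 γ) ≤ W2 ν μ.1 ^ 2 + ENNReal.ofReal (ε * c) ∧
      quadCost (margYX1 γ) ≤ W2 ν μ.2 ^ 2 + ENNReal.ofReal (ε * c) := by
  have hw₀ := W2_sq_ne_top hR ν μ.1
  have hw₁ := W2_sq_ne_top hR ν μ.2
  rw [Ffun_eq_coe hR, EReal.coe_lt_coe_iff, div_lt_iff₀ hε] at h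
  have hMM : MM ν ε μ.1 μ.2 <
      ENNReal.ofReal (c * ε + (W2 ν μ.1 ^ 2).toReal + (W2 ν μ.2 ^ 2).toReal) := by
    rw [ENNReal.lt_ofReal_iff_toReal_lt (MM_ne_top hR ν μ.1 μ.2 ε)]
    linarith
  simp only [MM, iInf_lt_iff] at hMM
  obtain ⟨γ, hγ, hlt⟩ := hMM
  rw [lintegral_MM_cost] at hlt
  have hA : ∫⁻ p, edist p.2.1 p.2.2 ^ 2 ∂(γ : Measure (X × X × X)) ≠ ⊤ :=
    (lintegral_edist_sq_lt_top hR γ _ _).ne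
  have hB₀ : quadCost (margYX0 γ) ≠ ⊤ :=
    (lintegral_edist_sq_lt_top hR (margYX0 γ) Prod.fst Prod.snd).ne
  have hB₁ : quadCost (margYX1 γ) ≠ ⊤ :=
    (lintegral_edist_sq_lt_top hR (margYX1 γ) Prod.fst Prod.snd).ne
  have hle₀ : W2 ν μ.1 ^ 2 ≤ quadCost (margYX0 γ) := by
    rw [W2_sq]
    exact iInf₂_le _ (margYX0_mem_couplings hγ)
  have hle₁ : W2 ν μ.2 ^ 2 ≤ quadCost (margYX1 γ) := by
    rw [W2_sq]
    exact iInf₂_le _ (margYX1_mem_couplings hγ)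
  suffices h' : 0 ≤ c ∧ (∫⁻ p, edist p.2.1 p.2.2 ^ 2 ∂(γ : Measure (X × X × X)) ≤
      ENNReal.ofReal c ∧ quadCost (margYX0 γ) ≤ W2 ν μ.1 ^ 2 + ENNReal.ofReal (ε * c) ∧
      quadCost (margYX1 γ) ≤ W2 ν μ.2 ^ 2 + ENNReal.ofReal (ε * c)) from ⟨h'.1, γ, hγ, h'.2⟩
  set A := ∫⁻ p, edist p.2.1 p.2.2 ^ 2 ∂(γ : Measure (X × X × X))
  lift A to ℝ≥0 using hA with a
  lift quadCost (margYX0 γ) to ℝ≥0 using hB₀ with b₀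
  lift quadCost (margYX1 γ) to ℝ≥0 using hB₁ with b₁
  lift W2 ν μ.1 ^ 2 to ℝ≥0 using hw₀ with w₀
  lift W2 ν μ.2 ^ 2 to ℝ≥0 using hw₁ with w₁
  have hlt' : ε * a + b₀ + b₁ < c * ε + w₀ + w₁ := by
    rw [ENNReal.lt_ofReal_iff_toReal_lt (by simp [ENNReal.mul_eq_top]),
      ENNReal.toReal_add (by simp [ENNReal.mul_eq_top]) (by simp),
      ENNReal.toReal_add (by simp [ENNReal.mul_eq_top]) (by simp),
      ENNReal.toReal_mul, ENNReal.toReal_ofReal hε.le] at hlt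
    simpa using hlt
  -- The excesses `b₀ - w₀`, `b₁ - w₁` and `ε * a` are nonnegative with sum below `c * ε`, so each
  -- one is below `c * ε`.
  have h₀ : (w₀ : ℝ) ≤ b₀ := by exact_mod_cast hle₀
  have h₁ : (w₁ : ℝ) ≤ b₁ := by exact_mod_cast hle₁
  have ha : 0 ≤ ε * (a : ℝ) := by positivity
  have hac : (a : ℝ) ≤ c := by
    refine le_of_mul_le_mul_left (a := ε) ?_ hε
    linarith
  have hεc : 0 ≤ ε * c := by nlinarith
  refine ⟨a.coe_nonneg.trans hac, ?_, ?_, ?_⟩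
  · rw [← ENNReal.ofReal_coe_nnreal]
    exact ENNReal.ofReal_le_ofReal hac
  · rw [← ENNReal.ofReal_coe_nnreal, ← ENNReal.ofReal_coe_nnreal (p := w₀),
      ← ENNReal.ofReal_add (by positivity) hεc]
    exact ENNReal.ofReal_le_ofReal (by linarith)
  · rw [← ENNReal.ofReal_coe_nnreal, ← ENNReal.ofReal_coe_nnreal (p := w₁),
      ← ENNReal.ofReal_add (by positivity) hεc]
    exact ENNReal.ofReal_le_ofReal (by linarith)

/-- A limit of almost optimal plans from `ν` to a weakly convergent family is optimal. -/
lemma mem_optCouplings_of_tendsto (hX : TotallyBounded (Set.univ : Set X)) {ι : Type*}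
    {l : Filter ι} [l.NeBot] {ν μ : ProbabilityMeasure X} {u : ι → ProbabilityMeasure X}
    (hu : Tendsto u l (𝓝 μ)) {πs : ι → ProbabilityMeasure (X × X)} {r : ι → ℝ≥0∞}
    (hr : Tendsto r l (𝓝 0)) (hπs : ∀ᶠ i in l, quadCost (πs i) ≤ W2 ν (u i) ^ 2 + r i)
    {π : ProbabilityMeasure (X × X)} (hπ : π ∈ couplings ν μ)
    (hlim : Tendsto (fun i => quadCost (πs i)) l (𝓝 (quadCost π))) :
    π ∈ optCouplings ν μ := by
  refine ⟨hπ, fun π' hπ' => ENNReal.le_of_forall_pos_le_add fun κ hκ _ => ?_⟩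
  have hκ' : (0 : ℝ) < κ := by exact_mod_cast hκ
  have hlim' : Tendsto (fun i => quadCost π' + κ + r i) l (𝓝 (quadCost π' + κ + 0)) :=
    tendsto_const_nhds.add hr
  rw [add_zero] at hlim'
  refine le_of_tendsto_of_tendsto hlim hlim' ?_
  -- A competitor `π'` for the limit target becomes a competitor `σ` for `u i` at extra cost `κ`,
  -- and `πs i` is almost as cheap as `σ`.
  filter_upwards [hπs, hu.eventually (eventually_exists_coupling_quadCost_le hX hπ' hκ')]
    with i hi ⟨σ, hσ, hle⟩
  rw [ENNReal.ofReal_coe_nnreal] at hle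
  calc quadCost (πs i) ≤ W2 ν (u i) ^ 2 + r i := hi
    _ ≤ quadCost σ + r i := by
      gcongr
      rw [W2_sq]
      exact iInf₂_le σ hσ
    _ ≤ quadCost π' + κ + r i := by gcongr

/-- The lower bound: plans with bounded cost and almost optimal projections accumulate at a
competitor for `Wbased`. -/
lemma Wbased_sq_le_of_frequently {K : Type*} [MetricSpace K] [MeasurableSpace K] [BorelSpace K]
    [CompactSpace K] {j : X → K} (hji : Isometry j) (hj : MeasurableEmbedding j)
    {ν : ProbabilityMeasure X} {μ : ProbabilityMeasure X × ProbabilityMeasure X}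
    {u : ℝ → ProbabilityMeasure X × ProbabilityMeasure X} (hu : Tendsto u (𝓝[>] 0) (𝓝 μ)) {c : ℝ}
    (h : ∃ᶠ ε in 𝓝[>] (0 : ℝ), ∃ γ ∈ couplings3 ν (u ε).1 (u ε).2,
      ∫⁻ p, edist p.2.1 p.2.2 ^ 2 ∂(γ : Measure (X × X × X)) ≤ ENNReal.ofReal c ∧
      quadCost (margYX0 γ) ≤ W2 ν (u ε).1 ^ 2 + ENNReal.ofReal (ε * c) ∧
      quadCost (margYX1 γ) ≤ W2 ν (u ε).2 ^ 2 + ENNReal.ofReal (ε * c)) :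
    Wbased ν μ.1 μ.2 ^ 2 ≤ ENNReal.ofReal c := by
  have hX : TotallyBounded (Set.univ : Set X) :=
    (totallyBounded_image_iff hji.isUniformInducing).1
      (isCompact_univ.totallyBounded.subset (Set.subset_univ _))
  obtain ⟨𝒰, h𝒰, hP⟩ := exists_ultrafilter_eventually_of_frequently h
  have : Nonempty (ProbabilityMeasure (X × X × X)) := ⟨(couplings3_nonempty ν ν ν).some⟩
  obtain ⟨γs, hγs⟩ := hP.choice
  have hu₀ : Tendsto (fun ε => (u ε).1) 𝒰 (𝓝 μ.1) :=
    (continuous_fst.tendsto _).comp (hu.mono_left h𝒰)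
  have hu₁ : Tendsto (fun ε => (u ε).2) 𝒰 (𝓝 μ.2) :=
    (continuous_snd.tendsto _).comp (hu.mono_left h𝒰)
  obtain ⟨γ, hγ, hlim⟩ := exists_limit_couplings3 hji.continuous hj 𝒰 hu₀ hu₁
    (hγs.mono fun _ h => h.1)
  have hr : Tendsto (fun ε : ℝ => ENNReal.ofReal (ε * c)) 𝒰 (𝓝 0) := by
    have : Tendsto (fun ε : ℝ => ENNReal.ofReal (ε * c)) (𝓝 0) (𝓝 (ENNReal.ofReal (0 * c))) :=
      (ENNReal.continuous_ofReal.comp (continuous_mul_const c)).tendsto 0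
    rw [zero_mul, ENNReal.ofReal_zero] at this
    exact this.mono_left (h𝒰.trans nhdsWithin_le_nhds)
  have hA := hlim (fun p => nndist p.2.1 p.2.2 ^ 2) (by fun_prop)
  have hB₀ := hlim (fun p => nndist p.2.1 p.1 ^ 2) (by fun_prop)
  have hB₁ := hlim (fun p => nndist p.2.2 p.1 ^ 2) (by fun_prop)
  simp only [hji.nndist_eq, ENNReal.coe_pow, ← edist_nndist] at hA hB₀ hB₁
  simp only [← quadCost_margYX0] at hB₀
  simp only [← quadCost_margYX1] at hB₁
  have hbased : γ ∈ basedCouplings ν μ.1 μ.2 :=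
    ⟨mem_optCouplings_of_tendsto hX hu₀ hr (hγs.mono fun _ h => h.2.2.1)
      (margYX0_mem_couplings hγ) hB₀,
    mem_optCouplings_of_tendsto hX hu₁ hr (hγs.mono fun _ h => h.2.2.2)
      (margYX1_mem_couplings hγ) hB₁⟩
  rw [Wbased_sq]
  exact (iInf₂_le γ hbased).trans (le_of_tendsto hA (hγs.mono fun _ h => h.2.1))

/-- Γ-convergence on a measurable subspace of a compact metric space. -/
theorem gammaConverges_Ffun {K : Type*} [MetricSpace K] [MeasurableSpace K] [BorelSpace K]
    [CompactSpace K] {j : X → K} (hji : Isometry j) (hj : MeasurableEmbedding j)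
    (ν : ProbabilityMeasure X) :
    GammaConverges (𝓝[>] (0 : ℝ))
      (fun (ε : ℝ) (μ : ProbabilityMeasure X × ProbabilityMeasure X) => Ffun ν ε μ)
      (fun μ => ((Wbased ν μ.1 μ.2 ^ 2 : ℝ≥0∞) : EReal)) := by
  obtain ⟨R, hR⟩ : ∃ R : ℝ≥0, ∀ x y : X, edist x y ≤ R := by
    obtain ⟨C, hC⟩ := Metric.isBounded_iff.1 (isCompact_univ (X := K)).isBounded
    refine ⟨C.toNNReal, fun x y => ?_⟩
    rw [← hji.edist_eq, edist_dist]
    exact ENNReal.ofReal_le_ofReal (hC (Set.mem_univ _) (Set.mem_univ _))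
  refine fun μ => ⟨fun u hu => ?_, fun _ => μ, tendsto_const_nhds, ?_⟩
  -- Any real `c` strictly above the liminf is shown to bound `Wbased ^ 2`; `c` is nonnegative
  -- because it dominates a cost, so `ENNReal.ofReal c` does not truncate it.
  · refine le_of_forall_gt fun b hb => ?_
    obtain ⟨c, hc, hcb⟩ := EReal.lt_iff_exists_real_btwn.1 hb
    have hfreq := frequently_lt_of_liminf_lt (by isBoundedDefault) hc
    have hfreq' := hfreq.and_eventually (self_mem_nhdsWithin (a := (0 : ℝ)) (s := Set.Ioi 0))
    have hplans := hfreq'.mono fun ε hε => exists_couplings3_of_Ffun_lt hR hε.2 hε.1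
    obtain ⟨ε, hc0, -⟩ := hplans.exists
    have hle := Wbased_sq_le_of_frequently hji hj hu (hplans.mono fun _ h => h.2)
    refine lt_of_le_of_lt (EReal.coe_ennreal_le_coe_ennreal_iff.2 hle) ?_
    rwa [EReal.coe_ennreal_ofReal, max_eq_left hc0]
  · refine limsup_le_of_le (by isBoundedDefault) ?_
    filter_upwards [self_mem_nhdsWithin] with ε hε using Ffun_le_Wbased_sq hR ν hε μ

end Functionals

/-- The inclusion of a measurable set into a larger set is a measurable embedding. -/
lemma measurableEmbedding_inclusion {α : Type*} [MeasurableSpace α] {s t : Set α} (h : s ⊆ t)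
    (hs : MeasurableSet s) : MeasurableEmbedding (Set.inclusion h) where
  injective := Set.inclusion_injective h
  measurable := measurable_inclusion h
  measurableSet_image' _ hu := hs.image_inclusion h hu

end BasedWasserstein

end

theorem mainTheorem10 (m : ℕ) (X : Set (EuclideanSpace ℝ (Fin m)))
    (hXmeas : MeasurableSet X) (hXconv : Convex ℝ X) (hXbdd : Bornology.IsBounded X)
    (ν : ProbabilityMeasure X) :
    BasedWasserstein.GammaConverges (𝓝[>] (0 : ℝ))
      (fun (ε : ℝ) (μ : ProbabilityMeasure X × ProbabilityMeasure X) =>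
        BasedWasserstein.Ffun ν ε μ)
      (fun μ => ((BasedWasserstein.Wbased ν μ.1 μ.2 ^ 2 : ℝ≥0∞) : EReal)) := by
  -- The compactification is the closure of `X`; measurability of `X` makes the inclusion a
  -- measurable embedding.
  have : CompactSpace (closure X) := isCompact_iff_compactSpace.1 hXbdd.isCompact_closure
  exact BasedWasserstein.gammaConverges_Ffun (j := Set.inclusion subset_closure) (fun _ _ => rfl)
    (BasedWasserstein.measurableEmbedding_inclusion subset_closure hXmeas) ν
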